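/- Let $\mathbb K\in\{\mathbb R,\mathbb C\}$. For a Banach space $X$ over $\mathbb K$ and a set $A\subset X^*$, the (I)-envelope of $A$ is $$\operatorname{(I)-env}(A)=\bigcap\left\{\overline{\operatorname{co}\bigcup_{n=1}^\infty \overline{\operatorname{co} A_n}^{\,w^*}}^{\,\|\cdot\|}\;:\; A=\bigcup_{n=1}^\infty A_n\right\},$$ where $\operatorname{co}$ denotes the convex hull and the intersection is taken over all representations of $A$ as the union of a sequence of sets $A_n$. Theorem. Let $K$ be an uncountable metrizable compact space, and let $\mathcal C(K)$ be the Banach space of continuous functions $K\to\mathbb K$ with the supremum norm. Then there is no locally convex vector space topology $\tau$ on $\mathcal C(K)^*$ such that $\operatorname{(I)-env}(A)=\overline{\operatorname{co}A}^{\,\tau}$ for every $A\subset\mathcal C(K)^*$. -/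

import Mathlib

open scoped Topology

/-- The weak-star closure of a subset of the dual of a normed space. -/
def weakStarClosure {𝕜 X : Type*} [RCLike 𝕜] [NormedAddCommGroup X] [NormedSpace 𝕜 X]
    (B : Set (StrongDual 𝕜 X)) : Set (StrongDual 𝕜 X) :=
  StrongDual.toWeakDual ⁻¹' closure (StrongDual.toWeakDual '' B)

/-- The (I)-envelope of a subset `A` of the dual of a normed space: the intersection, over all
countable covers `A = ⋃ n, S n`, of the norm-closed convex hulls of the union of the weak-star
closed convex hulls of the pieces `S n`. -/
def Ienv {𝕜 X : Type*} [RCLike 𝕜] [NormedAddCommGroup X] [NormedSpace 𝕜 X]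
    (A : Set (StrongDual 𝕜 X)) : Set (StrongDual 𝕜 X) :=
  ⋂ (S : ℕ → Set (StrongDual 𝕜 X)) (_ : A = ⋃ n, S n),
    closure (convexHull ℝ (⋃ n, weakStarClosure (convexHull ℝ (S n))))

/-- `τ` is a locally convex vector space topology on the `𝕜`-vector space `E`
(not required to be Hausdorff). -/
structure IsLocallyConvexTopology (𝕜 : Type*) {E : Type*} [RCLike 𝕜] [AddCommGroup E]
    [Module 𝕜 E] [Module ℝ E] (τ : TopologicalSpace E) : Prop where
  isTopologicalAddGroup : @IsTopologicalAddGroup E τ _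
  continuousSMul : @ContinuousSMul 𝕜 E _ _ τ
  locallyConvexSpace : @LocallyConvexSpace ℝ E _ _ _ _ τ

/-! Suppose such a `τ` exists. Embed the Cantor space in `K`; the sequences eventually 0 and those
eventually 1 give two increasing unions of closed sets, disjoint stage by stage. Urysohn functions
keep 0 out of the (I)-envelope of the set of differences of point masses between the two unions
(`zero_notMem_Ienv_sub_evalCLM`). Hahn–Banach for `τ` then gives a real-linear `φ` that exceeds some
`u > 0` on these differences and whose kernel is its own (I)-envelope. By
`exists_tendsto_of_Ienv_ker`, a positive multiple of `φ` is a pointwise limit of real parts of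
evaluations at elements of `C(K, 𝕜)`. So point masses turn `φ` into a Baire-one function on the
Cantor space that separates two dense sets by a gap, against `le_of_tendsto_of_dense`. -/

open Filter Set
open scoped Pointwise

/-! ### Compactness of convex hulls of finite unions. -/

section Compactness

variable {E : Type*} [AddCommGroup E] [Module ℝ E] [TopologicalSpace E] [ContinuousAdd E]
  [ContinuousSMul ℝ E]

theorem IsCompact.convexJoin {s t : Set E} (hs : IsCompact s) (ht : IsCompact t) :
    IsCompact (convexJoin ℝ s t) := by
  have h : _root_.convexJoin ℝ s t =
      (fun p : ℝ × E × E => (1 - p.1) • p.2.1 + p.1 • p.2.2) '' (Icc (0 : ℝ) 1 ×ˢ s ×ˢ t) := by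
    ext z
    simp only [mem_convexJoin, segment_eq_image, mem_image, mem_prod, Prod.exists]
    constructor
    · rintro ⟨a, ha, b, hb, θ, hθ, rfl⟩
      exact ⟨θ, a, b, ⟨hθ, ha, hb⟩, rfl⟩
    · rintro ⟨θ, a, b, ⟨hθ, ha, hb⟩, rfl⟩
      exact ⟨a, ha, b, hb, θ, hθ, rfl⟩
  rw [h]
  exact (isCompact_Icc.prod (hs.prod ht)).image (by fun_prop)

theorem IsCompact.convexHull_union {s t : Set E} (hs : IsCompact s) (ht : IsCompact t)
    (hs' : Convex ℝ s) (ht' : Convex ℝ t) : IsCompact (convexHull ℝ (s ∪ t)) := by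
  rcases s.eq_empty_or_nonempty with rfl | hsn
  · rwa [empty_union, ht'.convexHull_eq]
  rcases t.eq_empty_or_nonempty with rfl | htn
  · rwa [union_empty, hs'.convexHull_eq]
  rw [hs'.convexHull_union ht' hsn htn]
  exact hs.convexJoin ht

/-- No closure is taken, so these weak-star compact hulls stay inside the convex hull of the whole
union. -/
theorem isCompact_convexHull_accumulate {w : ℕ → Set E} (hw : ∀ n, IsCompact (w n))
    (hw' : ∀ n, Convex ℝ (w n)) (n : ℕ) : IsCompact (convexHull ℝ (accumulate w n)) := by
  induction n with
  | zero => rw [accumulate_zero_nat, (hw' 0).convexHull_eq]; exact hw 0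
  | succ n ih =>
    rw [accumulate_succ, ← convexHull_convexHull_union_left]
    exact ih.convexHull_union (hw _) (convex_convexHull ℝ _) (hw' _)

end Compactness

/-! ### Separation from (I)-envelopes by sequences in the predual. -/

section Separation

variable {𝕜 X : Type*} [RCLike 𝕜] [NormedAddCommGroup X] [NormedSpace 𝕜 X]

instance WeakDual.isScalarTower_real : IsScalarTower ℝ 𝕜 (WeakDual 𝕜 X) :=
  inferInstanceAs (IsScalarTower ℝ 𝕜 (X →L[𝕜] 𝕜))

/-- Shortcut instance: the additive monoid structure underlying the group structure. -/
noncomputable instance (priority := 2000) WeakDual.addCommMonoid_of_addCommGroup :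
    AddCommMonoid (WeakDual 𝕜 X) := AddCommGroup.toAddCommMonoid

/-- Shortcut instance for the real vector space structure on the weak-star dual. -/
noncomputable instance (priority := 2000) WeakDual.module_real : Module ℝ (WeakDual 𝕜 X) :=
  WeakDual.instModule' ..

/-- Shortcut instance for the real scalar multiplication on the weak-star dual. -/
noncomputable instance (priority := 2000) WeakDual.smul_real : SMul ℝ (WeakDual 𝕜 X) :=
  Module.toDistribMulAction.toDistribSMul.toSMul

instance WeakDual.locallyConvexSpace_real : LocallyConvexSpace ℝ (WeakDual 𝕜 X) :=
  WeakBilin.locallyConvexSpace (B := topDualPairing 𝕜 X)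

theorem Convex.preimage_toStrongDual {V : Set (StrongDual 𝕜 X)} (hV : Convex ℝ V) :
    Convex ℝ (WeakDual.toStrongDual ⁻¹' V : Set (WeakDual 𝕜 X)) :=
  fun _ ha _ hb _ _ hs ht hst => hV ha hb hs ht hst

theorem convexHull_image_toWeakDual (T : Set (StrongDual 𝕜 X)) :
    convexHull ℝ (StrongDual.toWeakDual '' T) = StrongDual.toWeakDual '' convexHull ℝ T :=
  (((StrongDual.toWeakDual (𝕜 := 𝕜) (E := X)).toLinearMap.restrictScalars ℝ).image_convexHull
    T).symm

theorem WeakDual.exists_re_lt_of_isClosed_of_convex {W : Set (WeakDual 𝕜 X)} (hW : IsClosed W)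
    (hWc : Convex ℝ W) {η : WeakDual 𝕜 X} (hη : η ∉ W) :
    ∃ (x : X) (u : ℝ), (∀ ξ ∈ W, RCLike.re (ξ x) < u) ∧ u < RCLike.re (η x) := by
  obtain ⟨f, u, hfu, huf⟩ := RCLike.geometric_hahn_banach_closed_point (𝕜 := 𝕜) hWc hW hη
  obtain ⟨x, rfl⟩ := LinearMap.dualEmbedding_surjective (topDualPairing 𝕜 X) f
  exact ⟨x, u, hfu, huf⟩

/-- An element of the unit ball separating a functional from a weak-star compact convex set
at positive distance. -/
theorem exists_norm_le_one_forall_re_add_le {W : Set (WeakDual 𝕜 X)} (hW : IsCompact W)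
    (hWc : Convex ℝ W) {η : StrongDual 𝕜 X} {r : ℝ} (hr : 0 < r)
    (hη : ∀ ξ ∈ W, r < dist η (WeakDual.toStrongDual ξ)) :
    ∃ x : X, ‖x‖ ≤ 1 ∧ ∀ ξ ∈ W, RCLike.re (ξ x) + r ≤ RCLike.re (η x) := by
  rcases W.eq_empty_or_nonempty with rfl | ⟨ξ₀, hξ₀⟩
  · exact ⟨0, by simp, by simp⟩
  -- The ball is weak-star compact, so `W + B` is closed; separating `η` from it gains `r * ‖x‖`
  -- over separating from `W`.
  set B : Set (WeakDual 𝕜 X) := WeakDual.toStrongDual ⁻¹' Metric.closedBall 0 r with hB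
  have hBc : IsCompact B := WeakDual.isCompact_closedBall 0 r
  have hBconv : Convex ℝ B := (convex_closedBall 0 r).preimage_toStrongDual
  have hmem : StrongDual.toWeakDual η ∉ W + B := by
    rintro ⟨a, ha, b, hb, hab⟩
    have h1 := hη a ha
    have h2 : η = WeakDual.toStrongDual a + WeakDual.toStrongDual b :=
      (congrArg WeakDual.toStrongDual hab).symm
    have h3 : ‖WeakDual.toStrongDual b‖ ≤ r := by simpa [hB] using hb
    rw [h2, dist_eq_norm, add_sub_cancel_left] at h1
    linarith
  obtain ⟨x, u, hsum, huf⟩ := WeakDual.exists_re_lt_of_isClosed_of_convex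
    (hW.add hBc).isClosed (hWc.add hBconv) hmem
  rw [StrongDual.toWeakDual_apply] at huf
  have hfu : ∀ ξ ∈ W, ∀ b ∈ B, RCLike.re (ξ x) + RCLike.re (b x) < u := by
    intro ξ hξ b hb
    rw [← map_add]
    exact hsum _ (add_mem_add hξ hb)
  obtain ⟨g, hg, hgx⟩ := exists_dual_vector'' 𝕜 x
  have key : ∀ ξ ∈ W, RCLike.re (ξ x) + r * ‖x‖ < RCLike.re (η x) := by
    intro ξ hξ
    have h1 : StrongDual.toWeakDual ((r : 𝕜) • g) ∈ B := by
      change (r : 𝕜) • g ∈ Metric.closedBall 0 r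
      rw [mem_closedBall_zero_iff, norm_smul, RCLike.norm_ofReal, abs_of_pos hr]
      exact mul_le_of_le_one_right hr.le hg
    have h2 := hfu ξ hξ _ h1
    have h3 : (StrongDual.toWeakDual ((r : 𝕜) • g)) x = ((r * ‖x‖ : ℝ) : 𝕜) := by
      rw [StrongDual.toWeakDual_apply, smul_apply, hgx]
      simp
    rw [h3, RCLike.ofReal_re] at h2
    linarith
  have hx : 0 < ‖x‖ := by
    rw [norm_pos_iff]
    rintro rfl
    have := key ξ₀ hξ₀
    simp at this
  refine ⟨((‖x‖⁻¹ : ℝ) : 𝕜) • x, ?_, fun ξ hξ => ?_⟩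
  · rw [norm_smul, RCLike.norm_ofReal, abs_of_pos (inv_pos.2 hx), inv_mul_cancel₀ hx.ne']
  · have h := mul_le_mul_of_nonneg_left (key ξ hξ).le (inv_pos.2 hx).le
    rw [map_smul ξ, map_smul η, smul_eq_mul, smul_eq_mul, RCLike.re_ofReal_mul,
      RCLike.re_ofReal_mul]
    calc _ = ‖x‖⁻¹ * (RCLike.re (ξ x) + r * ‖x‖) := by field_simp
      _ ≤ _ := h

/-- The hull of the first pieces of a witnessing cover, cut to bounded sets, is weak-star compact
and uniformly far from `η`. One vector separates each such hull, and every point of `A` lies in all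
but finitely many of them. -/
theorem exists_seq_separating_of_notMem_Ienv {A : Set (StrongDual 𝕜 X)} {η : StrongDual 𝕜 X}
    (hη : η ∉ Ienv A) :
    ∃ (x : ℕ → X) (r : ℝ), 0 < r ∧ (∀ n, ‖x n‖ ≤ 1) ∧
      ∀ ξ ∈ A, ∀ᶠ n in atTop, RCLike.re (ξ (x n)) + r ≤ RCLike.re (η (x n)) := by
  simp only [Ienv, mem_iInter, not_forall] at hη
  obtain ⟨S, hS, hη⟩ := hη
  set V := convexHull ℝ (⋃ n, weakStarClosure (convexHull ℝ (S n))) with hV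
  obtain ⟨ε, hε, hball⟩ := Metric.mem_nhds_iff.1 (isClosed_closure.isOpen_compl.mem_nhds hη)
  have hdist : ∀ ξ ∈ V, ε / 2 < dist η ξ := by
    intro ξ hξ
    by_contra! h
    exact hball (by rw [Metric.mem_ball, dist_comm]; linarith) (subset_closure hξ)
  -- The index `n` codes a pair (piece, radius).
  obtain ⟨w, hwdef⟩ : ∃ w : ℕ → Set (WeakDual 𝕜 X), ∀ n, w n =
    closure (convexHull ℝ (StrongDual.toWeakDual ''
      (S n.unpair.1 ∩ Metric.closedBall 0 (n.unpair.2 : ℝ)))) := ⟨_, fun _ => rfl⟩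
  have hw' : ∀ n, Convex ℝ (w n) := fun n => by
    rw [hwdef]; exact (convex_convexHull ℝ _).closure
  have hw : ∀ n, IsCompact (w n) := by
    intro n
    rw [hwdef]
    refine (WeakDual.isCompact_closedBall (0 : StrongDual 𝕜 X)
      (n.unpair.2 : ℝ)).of_isClosed_subset isClosed_closure ?_
    refine closure_minimal ?_ (WeakDual.isClosed_closedBall 0 _)
    rw [convexHull_image_toWeakDual]
    rintro _ ⟨ξ, hξ, rfl⟩
    exact convexHull_min inter_subset_right (convex_closedBall _ _) hξ
  have hVc : Convex ℝ V := convex_convexHull ℝ _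
  have hwV : ∀ n, ∀ ξ ∈ convexHull ℝ (accumulate w n), WeakDual.toStrongDual ξ ∈ V := by
    intro n ξ hξ
    suffices hsub : accumulate w n ⊆ (WeakDual.toStrongDual ⁻¹' V : Set (WeakDual 𝕜 X)) from
      convexHull_min hsub hVc.preimage_toStrongDual hξ
    intro ζ hζ
    obtain ⟨k, -, hk⟩ := mem_accumulate.1 hζ
    change WeakDual.toStrongDual ζ ∈ V
    refine subset_convexHull ℝ _ (mem_iUnion.2 ⟨k.unpair.1, ?_⟩)
    rw [hwdef, convexHull_image_toWeakDual] at hk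
    have hmono := closure_mono (image_mono (f := StrongDual.toWeakDual (𝕜 := 𝕜) (E := X))
      (convexHull_mono (𝕜 := ℝ) (inter_subset_left (s := S k.unpair.1)
        (t := Metric.closedBall 0 (k.unpair.2 : ℝ)))))
    exact hmono hk
  choose x hx1 hx2 using fun n => exists_norm_le_one_forall_re_add_le
    (isCompact_convexHull_accumulate hw hw' n) (convex_convexHull ℝ _) (half_pos hε)
    (fun ξ hξ => hdist _ (hwV n ξ hξ))
  refine ⟨x, ε / 2, half_pos hε, hx1, fun ξ hξ => ?_⟩
  rw [hS] at hξ
  obtain ⟨i, hi⟩ := mem_iUnion.1 hξ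
  obtain ⟨j, hj⟩ := exists_nat_ge ‖ξ‖
  filter_upwards [eventually_ge_atTop (Nat.pair i j)] with n hn
  refine hx2 n (StrongDual.toWeakDual ξ) (subset_convexHull ℝ _ (mem_accumulate.2 ⟨_, hn, ?_⟩))
  rw [hwdef]
  refine subset_closure (subset_convexHull ℝ _ (mem_image_of_mem _ ?_))
  rw [Nat.unpair_pair]
  exact ⟨hi, mem_closedBall_zero_iff.2 hj⟩

/-- A real-linear functional whose kernel is its own (I)-envelope is a positive multiple of a
pointwise limit of a bounded sequence of evaluations. -/
theorem exists_tendsto_of_Ienv_ker {φ : StrongDual 𝕜 X →ₗ[ℝ] ℝ}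
    (hφ : Ienv {ξ | φ ξ = 0} = {ξ | φ ξ = 0}) {η : StrongDual 𝕜 X} (hη : φ η = 1) :
    ∃ (x : ℕ → X) (s : ℝ), 0 < s ∧
      ∀ μ, Tendsto (fun n => RCLike.re (μ (x n))) atTop (𝓝 (s * φ μ)) := by
  have hη' : η ∉ Ienv {ξ | φ ξ = 0} := by rw [hφ]; simp [hη]
  obtain ⟨x, r, hr, hx, hsep⟩ := exists_seq_separating_of_notMem_Ienv hη'
  have hbd : ∀ n, |RCLike.re (η (x n))| ≤ ‖η‖ := fun n =>
    (RCLike.abs_re_le_norm _).trans ((η.le_opNorm _).trans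
      (mul_le_of_le_one_right (norm_nonneg _) (hx n)))
  have hzero : ∀ ξ, φ ξ = 0 → Tendsto (fun n => RCLike.re (ξ (x n))) atTop (𝓝 0) := by
    intro ξ hξ
    rw [Metric.tendsto_atTop']
    intro ε hε
    -- The kernel is closed under scaling, while the right-hand side of `hsep` is at most `‖η‖`; so
    -- large multiples of `±ξ` force the values at `ξ` below `ε`.
    have hc : 0 < (‖η‖ + 1) / ε := by positivity
    have hmul : ∀ (t : ℝ) n, RCLike.re ((t • ξ) (x n)) = t * RCLike.re (ξ (x n)) := by
      intro t n
      rw [smul_apply, RCLike.smul_re]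
    have h1 := hsep (((‖η‖ + 1) / ε) • ξ) (by simp [hξ])
    have h2 := hsep ((-((‖η‖ + 1) / ε)) • ξ) (by simp [hξ])
    obtain ⟨N, hN⟩ := (h1.and h2).exists_forall_of_atTop
    refine ⟨N, fun n hn => ?_⟩
    obtain ⟨h3, h4⟩ := hN n hn.le
    rw [hmul] at h3 h4
    have h5 := le_abs_self (RCLike.re (η (x n)))
    have h6 := hbd n
    have h7 : (‖η‖ + 1) / ε * |RCLike.re (ξ (x n))| < (‖η‖ + 1) / ε * ε := by
      rw [div_mul_cancel₀ _ hε.ne']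
      rcases abs_cases (RCLike.re (ξ (x n))) with ⟨h, -⟩ | ⟨h, -⟩ <;> rw [h] <;> linarith
    rw [Real.dist_eq, sub_zero]
    exact lt_of_mul_lt_mul_left h7 hc.le
  obtain ⟨s, -, ψ, hψ, hlim⟩ := tendsto_subseq_of_bounded
    (Metric.isBounded_closedBall (x := (0 : ℝ)) (r := ‖η‖))
    (x := fun n => RCLike.re (η (x n))) (fun n => by simpa using hbd n)
  -- The separation inequality at `0`, which lies in the kernel, keeps the limit positive.
  have hs : r ≤ s := by
    refine ge_of_tendsto hlim ?_
    filter_upwards [hψ.tendsto_atTop.eventually (hsep 0 (by simp))] with n hn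
    simpa using hn
  refine ⟨x ∘ ψ, s, hr.trans_le hs, fun μ => ?_⟩
  have h0 := (hzero (μ - φ μ • η) (by simp [hη])).comp hψ.tendsto_atTop
  have := h0.add (hlim.const_mul (φ μ))
  rw [zero_add, mul_comm] at this
  refine this.congr fun n => ?_
  simp [RCLike.smul_re]

end Separation

/-! ### Hahn–Banach for `τ`, and a Baire category argument. -/

theorem IsLocallyConvexTopology.exists_separating {𝕜 E : Type*} [RCLike 𝕜] [AddCommGroup E]
    [Module 𝕜 E] [Module ℝ E] [IsScalarTower ℝ 𝕜 E] {τ : TopologicalSpace E}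
    (hτ : IsLocallyConvexTopology 𝕜 τ) {A : Set E} {x : E}
    (hx : x ∉ closure[τ] (convexHull ℝ A)) :
    ∃ (φ : E →ₗ[ℝ] ℝ) (u : ℝ), φ x < u ∧ (∀ b ∈ A, u < φ b) ∧
      closure[τ] {ξ | φ ξ = 0} = {ξ | φ ξ = 0} := by
  have := hτ.isTopologicalAddGroup
  have := hτ.continuousSMul
  have := hτ.locallyConvexSpace
  have := IsScalarTower.continuousSMul (M := ℝ) (α := E) 𝕜
  obtain ⟨f, u, h1, h2⟩ :=
    geometric_hahn_banach_point_closed (convex_convexHull ℝ A).closure isClosed_closure hx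
  refine ⟨f.toLinearMap, u, h1, fun b hb => h2 b (subset_closure (subset_convexHull ℝ A hb)), ?_⟩
  exact (isClosed_eq f.continuous continuous_const).closure_eq

/-- A pointwise limit of continuous functions on a Baire space cannot separate two dense sets. -/
theorem le_of_tendsto_of_dense {Z : Type*} [TopologicalSpace Z] [BaireSpace Z] [Nonempty Z]
    {f : ℕ → Z → ℝ} {g : Z → ℝ} (hf : ∀ n, Continuous (f n))
    (hg : ∀ z, Tendsto (fun n => f n z) atTop (𝓝 (g z))) {D₁ D₂ : Set Z} (hD₁ : Dense D₁)
    (hD₂ : Dense D₂) {a b : ℝ} (ha : ∀ z ∈ D₁, g z ≤ a) (hb : ∀ z ∈ D₂, b ≤ g z) : b ≤ a := by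
  by_contra! hab
  obtain ⟨ε, hε, hεab⟩ : ∃ ε : ℝ, 0 < ε ∧ a + 4 * ε = b := ⟨(b - a) / 4, by linarith, by ring⟩
  let E : ℕ → Set Z := fun N => ⋂ m ≥ N, {z | |f m z - f N z| ≤ ε}
  have hE : ∀ N, IsClosed (E N) := fun N => isClosed_biInter fun m _ =>
    isClosed_le ((hf m).sub (hf N)).abs continuous_const
  have hE' : ⋃ N, E N = univ := by
    refine eq_univ_of_forall fun z => ?_
    obtain ⟨N, hN⟩ := Metric.cauchySeq_iff'.1 (hg z).cauchySeq ε hε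
    exact mem_iUnion.2 ⟨N, mem_iInter₂.2 fun m hm => (hN m hm).le⟩
  -- By Baire, the single continuous function `f N` is within `ε` of `g` on a nonempty open set.
  obtain ⟨N, hN⟩ := nonempty_interior_of_iUnion_of_closed hE hE'
  have hclose : ∀ z ∈ interior (E N), |g z - f N z| ≤ ε := by
    intro z hz
    refine le_of_tendsto ((hg z).sub_const _).abs ?_
    filter_upwards [eventually_ge_atTop N] with m hm
    exact mem_iInter₂.1 (interior_subset hz) m hm
  obtain ⟨q, hqE, hq⟩ := hD₂.inter_open_nonempty _ isOpen_interior hN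
  have hq1 := abs_le.1 (hclose q hqE)
  have hq2 := hb q hq
  obtain ⟨c, ⟨hcE, hc1⟩, hc⟩ := hD₁.inter_open_nonempty
    (interior (E N) ∩ {z | b - 2 * ε < f N z})
    (isOpen_interior.inter (isOpen_lt continuous_const (hf N)))
    ⟨q, hqE, by rw [mem_ofPred_eq]; linarith⟩
  have hc2 := abs_le.1 (hclose c hcE)
  have hc3 := ha c hc
  rw [mem_ofPred_eq] at hc1
  linarith

/-! ### Eventually constant binary sequences. -/

/-- Binary sequences that are constantly equal to `b` from the index `n` on. -/
def tailConst (b : Bool) (n : ℕ) : Set (ℕ → Bool) := {x | ∀ k ≥ n, x k = b}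

theorem monotone_tailConst (b : Bool) : Monotone (tailConst b) :=
  fun _ _ h _ hx k hk => hx k (h.trans hk)

theorem isClosed_tailConst (b : Bool) (n : ℕ) : IsClosed (tailConst b n) := by
  simp only [tailConst, ofPred_forall]
  exact isClosed_biInter fun k _ => isClosed_eq (continuous_apply k) continuous_const

theorem disjoint_tailConst (n : ℕ) : Disjoint (tailConst false n) (tailConst true n) := by
  rw [disjoint_left]
  intro x h1 h2
  simpa [h1 n le_rfl] using h2 n le_rfl

theorem dense_iUnion_tailConst (b : Bool) : Dense (⋃ n, tailConst b n) := by
  intro x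
  refine mem_closure_of_tendsto (f := fun n k => if k < n then x k else b) (b := atTop)
    (tendsto_pi_nhds.2 fun k => tendsto_const_nhds.congr' ?_) (Eventually.of_forall fun n => ?_)
  · filter_upwards [eventually_gt_atTop k] with n hn
    simp [hn]
  · exact mem_iUnion.2 ⟨n, fun k hk => by simp [not_lt.2 hk]⟩

theorem apply_eq_of_mem_weakStarClosure {𝕜 X : Type*} [RCLike 𝕜] [NormedAddCommGroup X] [NormedSpace 𝕜 X]
    {B : Set (StrongDual 𝕜 X)} {x : X} {c : 𝕜} (h : ∀ μ ∈ B, μ x = c) :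
    ∀ μ ∈ weakStarClosure B, μ x = c := by
  intro μ hμ
  have hcl : IsClosed {ν : WeakDual 𝕜 X | ν x = c} :=
    isClosed_eq (WeakDual.eval_continuous x) continuous_const
  exact closure_minimal (t := {ν : WeakDual 𝕜 X | ν x = c})
    (by rintro _ ⟨ν, hν, rfl⟩; exact h ν hν) hcl hμ

theorem convex_setOf_apply_eq {𝕜 X : Type*} [RCLike 𝕜] [NormedAddCommGroup X] [NormedSpace 𝕜 X]
    (x : X) (c : 𝕜) : Convex ℝ {μ : StrongDual 𝕜 X | μ x = c} := by
  intro μ hμ ν hν s t _ _ hst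
  simp only [mem_ofPred_eq] at hμ hν ⊢
  rw [add_apply, smul_apply, smul_apply, hμ, hν, ← add_smul, hst, one_smul]

/-! ### Differences of point masses on `C(K, 𝕜)`. -/

section ContinuousMap

variable {𝕜 K : Type*} [RCLike 𝕜] [TopologicalSpace K] [CompactSpace K]

/-- Differences of point masses over two increasing sequences of pairwise disjoint closed sets
stay away from zero even after taking the (I)-envelope. -/
theorem zero_notMem_Ienv_sub_evalCLM [T2Space K] {F G : ℕ → Set K} (hF : ∀ n, IsClosed (F n))
    (hG : ∀ n, IsClosed (G n)) (hFm : Monotone F) (hGm : Monotone G)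
    (hFG : ∀ n, Disjoint (F n) (G n)) :
    (0 : StrongDual 𝕜 C(K, 𝕜)) ∉ Ienv {μ | ∃ p ∈ ⋃ n, G n, ∃ q ∈ ⋃ n, F n,
      μ = ContinuousMap.evalCLM 𝕜 p - ContinuousMap.evalCLM 𝕜 q} := by
  choose f hf0 hf1 hf using fun n => exists_continuous_zero_one_of_isClosed (hF n) (hG n) (hFG n)
  let h : ℕ → C(K, 𝕜) := fun n => ⟨fun x => (f n x : 𝕜), by fun_prop⟩
  have hh : ∀ n, ‖h n‖ ≤ 1 := fun n => (ContinuousMap.norm_le _ zero_le_one).2 fun x => by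
    change ‖(f n x : 𝕜)‖ ≤ 1
    rw [RCLike.norm_ofReal, abs_of_nonneg (hf n x).1]
    exact (hf n x).2
  let S : ℕ → Set (StrongDual 𝕜 C(K, 𝕜)) := fun n => {μ | ∃ p ∈ G n, ∃ q ∈ F n,
    μ = ContinuousMap.evalCLM 𝕜 p - ContinuousMap.evalCLM 𝕜 q}
  have hSh : ∀ n, ∀ m ≥ n, ∀ μ ∈ S n, μ (h m) = 1 := by
    rintro n m hm _ ⟨p, hp, q, hq, rfl⟩
    change (f m p : 𝕜) - (f m q : 𝕜) = 1
    rw [hf1 m (hGm hm hp), hf0 m (hFm hm hq)]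
    simp
  -- Asking for the value 1 only eventually makes `T` a convex set containing all the pieces; since
  -- `‖h m‖ ≤ 1`, its members have norm at least 1.
  let T : Set (StrongDual 𝕜 C(K, 𝕜)) := {μ | ∀ᶠ m in atTop, μ (h m) = 1}
  have hT : Convex ℝ T := by
    intro μ hμ ν hν s t hs ht hst
    filter_upwards [hμ, hν] with m h1 h2
    exact convex_setOf_apply_eq (h m) 1 h1 h2 hs ht hst
  have hsub : convexHull ℝ (⋃ n, weakStarClosure (convexHull ℝ (S n))) ⊆ T := by
    refine convexHull_min (iUnion_subset fun n μ hμ => ?_) hT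
    filter_upwards [eventually_ge_atTop n] with m hm
    exact apply_eq_of_mem_weakStarClosure (fun ν hν =>
      convexHull_min (hSh n m hm) (convex_setOf_apply_eq (h m) 1) hν) μ hμ
  have hTnorm : T ⊆ {μ | 1 ≤ ‖μ‖} := by
    intro μ hμ
    obtain ⟨m, hm⟩ := hμ.exists
    have := (μ.le_opNorm (h m)).trans (mul_le_of_le_one_right (norm_nonneg μ) (hh m))
    rwa [hm, norm_one] at this
  simp only [Ienv, mem_iInter, not_forall]
  refine ⟨S, ?_, fun h0 => ?_⟩
  · ext μ
    simp only [mem_ofPred_eq, mem_iUnion, S]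
    constructor
    · rintro ⟨p, ⟨i, hp⟩, q, ⟨j, hq⟩, rfl⟩
      -- Monotonicity puts both points at a common stage, so the `S n` cover the set.
      exact ⟨max i j, p, hGm (le_max_left i j) hp, q, hFm (le_max_right i j) hq, rfl⟩
    · rintro ⟨n, p, hp, q, hq, rfl⟩
      exact ⟨p, ⟨n, hp⟩, q, ⟨n, hq⟩, rfl⟩
  · have := closure_minimal (hsub.trans hTnorm) (isClosed_le continuous_const continuous_norm) h0
    simp only [mem_ofPred_eq, norm_zero] at this
    exact absurd this (by norm_num)

end ContinuousMap

theorem theoremT (𝕜 : Type*) [RCLike 𝕜] (K : Type*) [TopologicalSpace K] [CompactSpace K]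
    [TopologicalSpace.MetrizableSpace K] [Uncountable K] :
    ¬ ∃ τ : TopologicalSpace (StrongDual 𝕜 C(K, 𝕜)),
      IsLocallyConvexTopology 𝕜 τ ∧
        ∀ A : Set (StrongDual 𝕜 C(K, 𝕜)), Ienv A = closure[τ] (convexHull ℝ A) := by
  rintro ⟨τ, hτ, henv⟩
  let _ := TopologicalSpace.metrizableSpaceMetric K
  obtain ⟨ι, -, hι, hinj⟩ := isClosed_univ.exists_nat_bool_injection_of_not_countable (α := K)
    (by rw [countable_univ_iff]; exact not_countable)
  have hclosed : ∀ b n, IsClosed (ι '' tailConst b n) := fun b n =>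
    ((isClosed_tailConst b n).isCompact.image hι).isClosed
  have h0 := zero_notMem_Ienv_sub_evalCLM (𝕜 := 𝕜) (hclosed false) (hclosed true)
    (fun _ _ h => image_mono (monotone_tailConst false h))
    (fun _ _ h => image_mono (monotone_tailConst true h))
    (fun n => disjoint_image_of_injective hinj (disjoint_tailConst n))
  rw [henv] at h0
  obtain ⟨φ, u, hu, hφA, hφ⟩ := hτ.exists_separating h0
  rw [map_zero] at hu
  have hker : Ienv {ξ | φ ξ = 0} = {ξ | φ ξ = 0} := by
    have hconv : Convex ℝ {ξ | φ ξ = 0} := φ.ker.convex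
    rw [henv, hconv.convexHull_eq, hφ]
  let δ : (ℕ → Bool) → StrongDual 𝕜 C(K, 𝕜) := fun z => ContinuousMap.evalCLM 𝕜 (ι z)
  have hsep : ∀ p ∈ ⋃ n, tailConst true n, ∀ q ∈ ⋃ n, tailConst false n,
      u < φ (δ p) - φ (δ q) := by
    intro p hp q hq
    rw [← map_sub]
    refine hφA _ ⟨ι p, ?_, ι q, ?_, rfl⟩
    · rw [← image_iUnion]; exact mem_image_of_mem ι hp
    · rw [← image_iUnion]; exact mem_image_of_mem ι hq
  obtain ⟨p₀, hp₀⟩ := (dense_iUnion_tailConst true).nonempty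
  obtain ⟨q₀, hq₀⟩ := (dense_iUnion_tailConst false).nonempty
  have hpos : 0 < φ (δ p₀ - δ q₀) := by
    rw [map_sub]; exact hu.trans (hsep p₀ hp₀ q₀ hq₀)
  obtain ⟨x, s, hs, hlim⟩ := exists_tendsto_of_Ienv_ker hker
    (η := (φ (δ p₀ - δ q₀))⁻¹ • (δ p₀ - δ q₀))
    (by rw [map_smul, smul_eq_mul, inv_mul_cancel₀ hpos.ne'])
  -- The pairwise gap `s * u` becomes a gap between two fixed levels, `a` and `a + s * u`.
  let a := sSup ((fun q => s * φ (δ q)) '' ⋃ n, tailConst false n)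
  have hbdd : BddAbove ((fun q => s * φ (δ q)) '' ⋃ n, tailConst false n) := by
    refine ⟨s * φ (δ p₀), ?_⟩
    rintro _ ⟨q, hq, rfl⟩
    have := hsep p₀ hp₀ q hq
    exact mul_le_mul_of_nonneg_left (by linarith) hs.le
  have hle : a + s * u ≤ a := by
    refine le_of_tendsto_of_dense (f := fun n z => RCLike.re (x n (ι z))) (fun n => by fun_prop)
      (fun z => hlim (δ z)) (dense_iUnion_tailConst false) (dense_iUnion_tailConst true)
      (fun q hq => le_csSup hbdd (mem_image_of_mem _ hq)) (fun p hp => ?_)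
    rw [← le_sub_iff_add_le]
    refine csSup_le (Nonempty.image _ ⟨q₀, hq₀⟩) ?_
    rintro _ ⟨q, hq, rfl⟩
    have := mul_le_mul_of_nonneg_left (hsep p hp q hq).le hs.le
    simp only
    linarith
  have := mul_pos hs hu
  linarith
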